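/- A compact space is a Corson compactum if it is homeomorphic to a subspace of $\{x\in\mathbb{R}^{\Gamma} : x_\gamma\neq 0 \text{ for at most countably many } \gamma\in\Gamma\}$ (with the topology of pointwise convergence) for some set $\Gamma$. A $\pi$-base of a space $X$ is a family $\mathcal{P}$ of non-empty open subsets of $X$ such that every non-empty open subset of $X$ contains a member of $\mathcal{P}$; the $\pi$-weight $\pi w(X)$ is the minimum cardinality of a $\pi$-base of $X$. **Corollary.** For every Corson compactum $X$ there is a non-empty Corson compactum $K$ such that $X\times K$ has a dense metrizable subspace. Moreover, one can take $K=A(\kappa)^{\omega}$, where $\kappa=\pi w(X)$ and $A(\kappa)$ is the one-point compactification of a discrete set of cardinality $\kappa$ (for finite $\kappa$: the discrete space with $\kappa+1$ points); that is, $A(\kappa)^{\omega}$ is a Corson compactum and $X\times A(\kappa)^{\omega}$ has a dense metrizable subspace. -/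

import Mathlib

open Topology Cardinal

universe u v

/-- The `Σ`-product of `ι`-many real lines: the points of `ℝ^ι` with countable support,
with the topology induced from the product topology. -/
def SigmaProduct (ι : Type v) : Set (ι → ℝ) :=
  {x | (Function.support x).Countable}

/-- A Corson compactum: a compact space that is homeomorphic to a subspace of some `Σ`-product of
real lines. (Hausdorffness is automatic. Restricting the index set to the universe of `X` is
harmless, see `isCorsonCompactum_of_isEmbedding`.) -/
def IsCorsonCompactum (X : Type u) [TopologicalSpace X] : Prop :=
  CompactSpace X ∧ ∃ (ι : Type u) (f : X → SigmaProduct ι), IsEmbedding f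

/-- A family `P` of non-empty open sets is a `π`-base if every non-empty open set contains a member
of `P`. -/
def IsPiBase {X : Type u} [TopologicalSpace X] (P : Set (Set X)) : Prop :=
  (∀ U ∈ P, IsOpen U ∧ U.Nonempty) ∧
    ∀ V : Set X, IsOpen V → V.Nonempty → ∃ U ∈ P, U ⊆ V

/-- The `π`-weight: the minimum cardinality of a `π`-base. -/
noncomputable def piWeight (X : Type u) [TopologicalSpace X] : Cardinal.{u} :=
  sInf {c | ∃ P : Set (Set X), IsPiBase P ∧ #P = c}

/-- `X` has a dense metrizable subspace. -/
def HasDenseMetrizableSubspace (X : Type u) [TopologicalSpace X] : Prop :=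
  ∃ D : Set X, Dense D ∧ TopologicalSpace.MetrizableSpace D

/-- The minimum in the definition of the `π`-weight is attained. -/
theorem exists_isPiBase_mk_eq_piWeight (X : Type u) [TopologicalSpace X] :
    ∃ P : Set (Set X), IsPiBase P ∧ #P = piWeight X := by
  have h : {c : Cardinal.{u} | ∃ P : Set (Set X), IsPiBase P ∧ #P = c}.Nonempty :=
    ⟨_, {U | IsOpen U ∧ U.Nonempty}, ⟨fun _ h => h, fun V h1 h2 => ⟨V, ⟨h1, h2⟩, subset_rfl⟩⟩, rfl⟩
  exact csInf_mem h

/-- The universe of the index set in the definition of a Corson compactum does not matter. -/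
theorem isCorsonCompactum_of_isEmbedding {X : Type u} [TopologicalSpace X] [CompactSpace X]
    {ι : Type v} (f : X → SigmaProduct ι) (hf : IsEmbedding f) : IsCorsonCompactum X := by
  refine ⟨inferInstance, {h : X → ℝ // ∃ i, h = fun x => (f x).1 i},
    fun x => ⟨fun h => h.1 x, ?_⟩, ?_⟩
  · refine ((f x).2.image (fun i =>
      (⟨fun y => (f y).1 i, i, rfl⟩ : {h : X → ℝ // ∃ i, h = fun x => (f x).1 i}))).mono ?_
    rintro ⟨_, i, rfl⟩ hi
    exact ⟨i, hi, rfl⟩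
  · have hc : Continuous fun x => (f x).1 := continuous_subtype_val.comp hf.continuous
    refine Topology.IsClosedEmbedding.isEmbedding (Continuous.isClosedEmbedding ?_ ?_)
    · refine Continuous.subtype_mk (continuous_pi ?_) _
      rintro ⟨_, i, rfl⟩
      exact (continuous_apply i).comp hc
    · intro x y hxy
      apply hf.injective
      ext i
      exact congrFun (congrArg Subtype.val hxy) ⟨_, i, rfl⟩

/-! A Hausdorff space with a σ-disjoint π-base and a dense set of points of countable character has
a dense metrizable subspace (`hasDenseMetrizableSubspace_of_sigmaDisjoint`). It is the set of all
points marked in a sequence of ever finer disjoint open families: old points are kept while their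
cells shrink along countable local bases, and every other cell decides more and more of the π-base.

The product meets both conditions. Maximal points for extension of supports give countable character
in `X`, and isolated points are dense in `A(κ)`. A π-base of `X` becomes σ-disjoint in the product
because one coordinate of `A(κ)^ω` can name the π-base member used. -/

/-- A space whose topology is generated by countably many partitions into open sets is
pseudometrizable. -/
theorem pseudoMetrizableSpace_of_isLocallyConstant {Z : Type*} {α : Type*} [TopologicalSpace Z]
    (φ : ℕ → Z → α) (hφ : ∀ n, IsLocallyConstant (φ n))
    (h : ∀ z, ∀ U ∈ 𝓝 z, ∃ n, ∀ w, φ n w = φ n z → w ∈ U) :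
    TopologicalSpace.PseudoMetrizableSpace Z := by
  let : UniformSpace α := ⊥
  have : DiscreteTopology α := ⟨rfl⟩
  have : TopologicalSpace.PseudoMetrizableSpace α := inferInstance
  have hc : Continuous fun z n => φ n z := continuous_pi fun n => (hφ n).continuous
  refine Topology.IsInducing.pseudoMetrizableSpace (f := fun z n => φ n z) ?_
  refine (isInducing_iff_nhds).2 fun z => le_antisymm (hc.tendsto z).le_comap fun U hU => ?_
  obtain ⟨n, hn⟩ := h z U hU
  refine ⟨(fun f : ℕ → α => f n) ⁻¹' {φ n z}, ?_, fun w hw => hn w hw⟩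
  exact ((isOpen_discrete {φ n z}).preimage (continuous_apply n)).mem_nhds rfl

/-! ### Refining pointed partitions -/

/-- A set `W` decides a family of sets if each member of the family contains `W` or is disjoint
from `W`. -/
def Decides {Y : Type*} (W : Set Y) (B : Set (Set Y)) : Prop :=
  ∀ S ∈ B, W ⊆ S ∨ Disjoint W S

theorem Decides.mono {Y : Type*} {V W : Set Y} {B : Set (Set Y)} (h : Decides W B) (hV : V ⊆ W) :
    Decides V B :=
  fun S hS => (h S hS).imp hV.trans (fun hd => hd.mono_left hV)

/-- The families are treated one at a time. If `W` meets a member `S`, then `W ∩ S` misses all other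
members by disjointness; if it meets none, `W` already decides the family. -/
theorem exists_decides {Y : Type*} [TopologicalSpace Y] {B : ℕ → Set (Set Y)}
    (hBo : ∀ n, ∀ S ∈ B n, IsOpen S) (hBd : ∀ n, (B n).PairwiseDisjoint id) (n : ℕ)
    {V : Set Y} (hV : IsOpen V) (hne : V.Nonempty) :
    ∃ W ⊆ V, IsOpen W ∧ W.Nonempty ∧ ∀ k < n, Decides W (B k) := by
  induction n with
  | zero => exact ⟨V, subset_rfl, hV, hne, fun k hk => absurd hk (Nat.not_lt_zero k)⟩
  | succ n ih =>
    obtain ⟨W, hWV, hWo, hWne, hW⟩ := ih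
    by_cases hS : ∃ S ∈ B n, (W ∩ S).Nonempty
    · obtain ⟨S, hSB, hne⟩ := hS
      refine ⟨W ∩ S, Set.inter_subset_left.trans hWV, hWo.inter (hBo n S hSB), hne, ?_⟩
      intro k hk
      rcases Nat.lt_succ_iff_lt_or_eq.1 hk with hk | rfl
      · exact (hW k hk).mono Set.inter_subset_left
      · intro S' hS'
        by_cases heq : S = S'
        · exact .inl (heq ▸ Set.inter_subset_right)
        · exact .inr ((hBd k hSB hS' heq).mono_left Set.inter_subset_right)
    · push Not at hS
      refine ⟨W, hWV, hWo, hWne, fun k hk => ?_⟩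
      rcases Nat.lt_succ_iff_lt_or_eq.1 hk with hk | rfl
      · exact hW k hk
      · exact fun S hSB => .inr (Set.disjoint_iff_inter_eq_empty.2 (hS S hSB))

/-- A disjoint family of pointed open sets: the underlying sets are open, pairwise
disjoint, with dense union, and the points are taken from `E`. -/
structure IsPointedPartition {Y : Type*} [TopologicalSpace Y] (E : Set Y)
    (T : Set (Set Y × Y)) : Prop where
  isOpen : ∀ p ∈ T, IsOpen p.1
  mem : ∀ p ∈ T, p.2 ∈ p.1
  point_mem : ∀ p ∈ T, p.2 ∈ E
  pairwise : T.Pairwise fun p q => Disjoint p.1 q.1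
  meets : ∀ V, IsOpen V → V.Nonempty → ∃ p ∈ T, (V ∩ p.1).Nonempty

theorem IsPointedPartition.eq_of_mem {Y : Type*} [TopologicalSpace Y] {E : Set Y}
    {T : Set (Set Y × Y)} (hT : IsPointedPartition E T) {p q : Set Y × Y} (hp : p ∈ T) (hq : q ∈ T)
    {y : Y} (hyp : y ∈ p.1) (hyq : y ∈ q.1) : p = q := by
  by_contra hne
  exact Set.disjoint_left.1 (hT.pairwise hp hq hne) hyp hyq

/-- Shrinking the old cells around their points may leave gaps. Zorn's lemma fills these with
deciding cells: a gap would contain one more admissible cell, against maximality. -/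
theorem IsPointedPartition.exists_refinement {Y : Type*} [TopologicalSpace Y] {E : Set Y}
    (hE : Dense E) {B : ℕ → Set (Set Y)} (hBo : ∀ n, ∀ S ∈ B n, IsOpen S)
    (hBd : ∀ n, (B n).PairwiseDisjoint id) (n : ℕ) {N : Y → Set Y} (hN : ∀ y ∈ E, N y ∈ 𝓝 y)
    {T : Set (Set Y × Y)} (hT : IsPointedPartition E T) :
    ∃ T' : Set (Set Y × Y), IsPointedPartition E T' ∧
      (∀ p ∈ T', p.1 ⊆ N p.2) ∧
      (∀ p ∈ T', ∃ q ∈ T, p.1 ⊆ q.1 ∧ (p.2 = q.2 ∨ ∀ k < n, Decides p.1 (B k))) ∧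
      ∀ p ∈ T, ∃ p' ∈ T', p'.2 = p.2 := by
  let good : Set (Set Y × Y) := {p | IsOpen p.1 ∧ p.2 ∈ p.1 ∧ p.2 ∈ E ∧ p.1 ⊆ N p.2 ∧
    ∃ q ∈ T, p.1 ⊆ q.1 ∧ (p.2 = q.2 ∨ ∀ k < n, Decides p.1 (B k))}
  let c : Set Y × Y → Set Y × Y := fun p => (p.1 ∩ interior (N p.2), p.2)
  let 𝒞 : Set (Set (Set Y × Y)) := {C | C ⊆ good ∧ C.Pairwise fun p q => Disjoint p.1 q.1}
  have hc : c '' T ∈ 𝒞 := by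
    constructor
    · rintro _ ⟨p, hp, rfl⟩
      exact ⟨(hT.isOpen p hp).inter isOpen_interior,
        ⟨hT.mem p hp, mem_interior_iff_mem_nhds.2 (hN _ (hT.point_mem p hp))⟩, hT.point_mem p hp,
        Set.inter_subset_right.trans interior_subset, p, hp, Set.inter_subset_left, .inl rfl⟩
    · rintro _ ⟨p, hp, rfl⟩ _ ⟨q, hq, rfl⟩ hne
      have hpq : p ≠ q := fun h => hne (h ▸ rfl)
      exact (hT.pairwise hp hq hpq).mono Set.inter_subset_left Set.inter_subset_left
  obtain ⟨T', hcT', hmax⟩ := zorn_subset_nonempty 𝒞 (fun C hC hchain _ =>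
    ⟨⋃₀ C, ⟨Set.sUnion_subset fun s hs => (hC hs).1,
      hchain.pairwise_sUnion.2 fun s hs => (hC hs).2⟩,
      fun s hs => Set.subset_sUnion_of_mem hs⟩) _ hc
  obtain ⟨hgood, hpair⟩ := hmax.prop
  refine ⟨T', ⟨fun p hp => (hgood hp).1, fun p hp => (hgood hp).2.1, fun p hp => (hgood hp).2.2.1,
    hpair, ?_⟩, fun p hp => (hgood hp).2.2.2.1, fun p hp => (hgood hp).2.2.2.2,
    fun p hp => ⟨c p, hcT' ⟨p, hp, rfl⟩, rfl⟩⟩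
  intro V hV hne
  by_contra! hcon
  obtain ⟨q, hq, hVq⟩ := hT.meets V hV hne
  obtain ⟨W, hWV, hWo, hWne, hW⟩ := exists_decides hBo hBd n (hV.inter (hT.isOpen q hq)) hVq
  obtain ⟨y, hyW, hyE⟩ := hE.inter_open_nonempty W hWo hWne
  have hyN : y ∈ W ∩ interior (N y) := ⟨hyW, mem_interior_iff_mem_nhds.2 (hN y hyE)⟩
  have hdisj : ∀ p ∈ T', Disjoint (W ∩ interior (N y)) p.1 := fun p hp =>
    (Set.disjoint_iff_inter_eq_empty.2 (hcon p hp)).mono_left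
      (Set.inter_subset_left.trans (hWV.trans Set.inter_subset_left))
  have hins : insert (W ∩ interior (N y), y) T' ∈ 𝒞 := by
    refine ⟨Set.insert_subset ⟨hWo.inter isOpen_interior, hyN, hyE,
      Set.inter_subset_right.trans interior_subset, q, hq,
      Set.inter_subset_left.trans (hWV.trans Set.inter_subset_right),
      .inr fun k hk => (hW k hk).mono Set.inter_subset_left⟩ hgood, ?_⟩
    exact hpair.insert fun p hp _ => ⟨hdisj p hp, (hdisj p hp).symm⟩
  have hmem := hmax.le_of_ge hins (Set.subset_insert _ _) (Set.mem_insert _ _)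
  exact Set.disjoint_left.1 (hdisj _ hmem) hyN hyN

/-- A Hausdorff space with a `σ`-disjoint `π`-base and a dense set of points of countable character
has a dense metrizable subspace. -/
theorem hasDenseMetrizableSubspace_of_sigmaDisjoint {Y : Type u} [TopologicalSpace Y] [T2Space Y]
    (hE : Dense {y : Y | (𝓝 y).IsCountablyGenerated}) {B : ℕ → Set (Set Y)}
    (hBo : ∀ n, ∀ S ∈ B n, IsOpen S) (hBd : ∀ n, (B n).PairwiseDisjoint id)
    (hB : ∀ V : Set Y, IsOpen V → V.Nonempty → ∃ n, ∃ S ∈ B n, S.Nonempty ∧ S ⊆ V) :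
    HasDenseMetrizableSubspace Y := by
  rcases isEmpty_or_nonempty Y with hY | hY
  · exact ⟨∅, fun y => hY.elim y, inferInstance⟩
  set E := {y : Y | (𝓝 y).IsCountablyGenerated} with hEdef
  have hbasis : ∀ y : Y, ∃ N : ℕ → Set Y, y ∈ E → (𝓝 y).HasAntitoneBasis N := by
    intro y
    by_cases hy : y ∈ E
    · have : (𝓝 y).IsCountablyGenerated := hy
      obtain ⟨N, hN⟩ := (𝓝 y).exists_antitone_basis
      exact ⟨N, fun _ => hN⟩
    · exact ⟨fun _ => ∅, fun h => absurd h hy⟩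
  choose N hN using hbasis
  obtain ⟨y₀, hy₀⟩ := hE.nonempty
  have hT₀ : IsPointedPartition E {((Set.univ : Set Y), y₀)} := by
    refine ⟨?_, ?_, ?_, Set.pairwise_singleton _ _, fun V _ hV => ⟨_, rfl, by simpa using hV⟩⟩ <;>
      rintro _ rfl
    exacts [isOpen_univ, Set.mem_univ _, hy₀]
  -- With `n + 1`, the new cells of stage `n + 1` decide `B 0, …, B n`.
  choose F hFpart hFN hFref hFkeep using fun (n : ℕ) (T : {T // IsPointedPartition E T}) =>
    T.2.exists_refinement hE hBo hBd (n + 1) (N := fun y => N y n)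
      (fun y hy => (hN y hy).toHasBasis.mem_of_mem trivial)
  let T : ℕ → {T // IsPointedPartition E T} := fun n =>
    Nat.rec ⟨_, hT₀⟩ (fun n t => ⟨F n t, hFpart n t⟩) n
  have hTN : ∀ n, ∀ p ∈ (T (n + 1)).1, p.1 ⊆ N p.2 n := fun n => hFN n (T n)
  have hTref : ∀ n, ∀ p ∈ (T (n + 1)).1, ∃ q ∈ (T n).1,
      p.1 ⊆ q.1 ∧ (p.2 = q.2 ∨ ∀ k < n + 1, Decides p.1 (B k)) := fun n => hFref n (T n)
  have hTkeep : ∀ n, ∀ p ∈ (T n).1, ∃ p' ∈ (T (n + 1)).1, p'.2 = p.2 := fun n => hFkeep n (T n)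
  have hup : ∀ m n, m ≤ n → ∀ p ∈ (T m).1, ∃ p' ∈ (T n).1, p'.2 = p.2 := by
    intro m n hmn p hp
    induction n, hmn using Nat.le_induction with
    | base => exact ⟨p, hp, rfl⟩
    | succ n _ ih =>
      obtain ⟨q, hq, hqp⟩ := ih
      obtain ⟨r, hr, hrq⟩ := hTkeep n q hq
      exact ⟨r, hr, hrq.trans hqp⟩
  have hdown : ∀ m n, m ≤ n → ∀ p ∈ (T n).1, ∃ q ∈ (T m).1, p.1 ⊆ q.1 := by
    intro m n hmn
    induction n, hmn using Nat.le_induction with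
    | base => exact fun p hp => ⟨p, hp, subset_rfl⟩
    | succ n _ ih =>
      intro p hp
      obtain ⟨q, hq, hpq, -⟩ := hTref n p hp
      obtain ⟨r, hr, hqr⟩ := ih q hq
      exact ⟨r, hr, hpq.trans hqr⟩
  let D : Set Y := {y | ∃ n, ∃ p ∈ (T n).1, p.2 = y}
  have hcover : ∀ (n : ℕ) (y : D), ∃ p ∈ (T n).1, y.1 ∈ p.1 := by
    rintro n ⟨_, m, p, hp, rfl⟩
    rcases le_total m n with hmn | hnm
    · obtain ⟨p', hp', h⟩ := hup m n hmn p hp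
      exact ⟨p', hp', by simpa only [h] using (T n).2.mem p' hp'⟩
    · obtain ⟨q, hq, hpq⟩ := hdown n m hnm p hp
      exact ⟨q, hq, hpq ((T m).2.mem p hp)⟩
  refine ⟨D, ?_, ?_⟩
  · refine dense_iff_inter_open.2 fun V hV hne => ?_
    obtain ⟨k, S, hSB, hSne, hSV⟩ := hB V hV hne
    have hSo := hBo k S hSB
    obtain ⟨p, hp, z, hzS, hzp⟩ := (T k).2.meets S hSo hSne
    -- From stage `k` on, a cell meeting `p.1` either descends from `p` with its point kept, or has
    -- an ancestor that received a new point and so decided `S`.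
    have hinv : ∀ n, k ≤ n → ∀ r ∈ (T n).1, (r.1 ∩ p.1).Nonempty →
        r.2 = p.2 ∨ r.1 ⊆ S ∨ Disjoint r.1 S := by
      intro n hkn
      induction n, hkn using Nat.le_induction with
      | base =>
        rintro r hr ⟨y, hyr, hyp⟩
        exact .inl (congrArg Prod.snd ((T k).2.eq_of_mem hr hp hyr hyp))
      | succ n hkn ih =>
        rintro r hr ⟨y, hyr, hyp⟩
        obtain ⟨q, hq, hrq, h⟩ := hTref n r hr
        rcases ih q hq ⟨y, hrq hyr, hyp⟩ with h' | h' | h'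
        · rcases h with h | h
          · exact .inl (h.trans h')
          · exact .inr (h k (Nat.lt_succ_of_le hkn) S hSB)
        · exact .inr (.inl (hrq.trans h'))
        · exact .inr (.inr (h'.mono_left hrq))
    by_cases hpS : p.2 ∈ S
    · exact ⟨p.2, hSV hpS, k, p, hp, rfl⟩
    -- At a late stage the cell of `p.2` lies in `G`, so a cell meeting `S ∩ p.1 ∩ H` has another
    -- point, hence lies inside `S`.
    obtain ⟨G, H, hGo, hHo, hpG, hzH, hGH⟩ := t2_separation (fun h : p.2 = z => hpS (h ▸ hzS))
    obtain ⟨m, -, hm⟩ := (hN p.2 ((T k).2.point_mem p hp)).toHasBasis.mem_iff.1 (hGo.mem_nhds hpG)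
    obtain ⟨r, hr, y, ⟨⟨hyS, hyp⟩, hyH⟩, hyr⟩ := (T (max k m + 1)).2.meets ((S ∩ p.1) ∩ H)
      ((hSo.inter ((T k).2.isOpen p hp)).inter hHo) ⟨z, ⟨hzS, hzp⟩, hzH⟩
    rcases hinv _ ((le_max_left k m).trans (Nat.le_succ _)) r hr ⟨y, hyr, hyp⟩ with h | h | h
    · refine absurd hyH (Set.disjoint_left.1 hGH (hm ?_))
      have := hTN _ r hr hyr
      rw [h] at this
      exact (hN p.2 ((T k).2.point_mem p hp)).antitone (le_max_right k m) this
    · exact ⟨r.2, hSV (h ((T (max k m + 1)).2.mem r hr)), max k m + 1, r, hr, rfl⟩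
    · exact absurd hyS (Set.disjoint_left.1 h hyr)
  · choose φ hφT hφ using hcover
    have : TopologicalSpace.PseudoMetrizableSpace D := by
      refine pseudoMetrizableSpace_of_isLocallyConstant φ (fun n => ?_) ?_
      · refine (IsLocallyConstant.iff_eventually_eq _).2 fun y => ?_
        filter_upwards [(((T n).2.isOpen _ (hφT n y)).preimage continuous_subtype_val).mem_nhds
          (hφ n y)] with w hw
        exact (T n).2.eq_of_mem (hφT n w) (hφT n y) (hφ n w) hw
      · rintro ⟨_, m, p, hp, rfl⟩ U hU
        obtain ⟨V, hV, hVU⟩ := mem_nhds_subtype _ _ _ |>.1 hU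
        have hNp := hN p.2 ((T m).2.point_mem p hp)
        obtain ⟨n, -, hn⟩ := hNp.toHasBasis.mem_iff.1 hV
        obtain ⟨p', hp', hpp'⟩ := hup m (max m n + 1) ((le_max_left m n).trans (Nat.le_succ _)) p hp
        refine ⟨max m n + 1, fun w hw => hVU (hn (hNp.antitone (le_max_right m n) ?_))⟩
        have h1 := hφ (max m n + 1) w
        have h2 : φ (max m n + 1) ⟨p.2, m, p, hp, rfl⟩ = p' :=
          (T (max m n + 1)).2.eq_of_mem (hφT (max m n + 1) _) hp' (hφ (max m n + 1) _)
            (by simpa only [hpp'] using (T (max m n + 1)).2.mem p' hp')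
        rw [hw, h2] at h1
        rw [← hpp']
        exact hTN _ p' hp' h1
    infer_instance

/-! ### Points of countable character in Corson compacta -/

/-- In a Corson compactum the points of countable character are dense. -/
theorem IsCorsonCompactum.dense_isCountablyGenerated_nhds {X : Type u} [TopologicalSpace X]
    (hX : IsCorsonCompactum X) : Dense {x : X | (𝓝 x).IsCountablyGenerated} := by
  obtain ⟨_, ι, g, hg⟩ := hX
  let f : X → ι → ℝ := fun x => (g x).1
  have hf : IsEmbedding f := IsEmbedding.subtypeVal.comp hg
  have hfi : ∀ i, Continuous fun x => f x i := fun i => (continuous_apply i).comp hf.continuous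
  refine dense_iff_inter_open.2 ?_
  rintro U hU ⟨x₀, hx₀⟩
  obtain ⟨V, hV, rfl⟩ := hf.isOpen_iff.1 hU
  obtain ⟨A, u, hu, hAV⟩ := isOpen_pi_iff.1 hV (f x₀) hx₀
  let r : X → X → Prop := fun x y => ∀ i, f x i ≠ 0 → f y i = f x i
  have hr : ∀ {x y z : X}, r x y → r y z → r x z := fun {x y z} hxy hyz i hi => by
    have h := hxy i hi
    rw [hyz i (h ▸ hi), h]
  let C := {x : X // ∀ i ∈ A, f x i = f x₀ i}
  have hCc : IsClosed {x : X | ∀ i ∈ A, f x i = f x₀ i} := by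
    simp only [Set.ofPred_forall]
    exact isClosed_biInter fun i _ => isClosed_eq (hfi i) continuous_const
  have : CompactSpace C := isCompact_iff_compactSpace.1 hCc.isCompact
  have : Nonempty C := ⟨⟨x₀, fun _ _ => rfl⟩⟩
  -- For Zorn's lemma, a chain is bounded because the sets of extensions of its members are closed
  -- and nested, so compactness gives a common point.
  obtain ⟨m, hm⟩ : ∃ m : C, ∀ a : C, r m a → r a m := by
    refine exists_maximal_of_nonempty_chains_bounded (r := fun a b : C => r a b) ?_
      (fun hab hbc => hr hab hbc)
    intro c hc hne
    have : Nonempty c := hne.to_subtype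
    have hcl : ∀ a : c, IsClosed {y : C | r a.1.1 y.1} := fun a => by
      simp only [r, Set.ofPred_forall]
      exact isClosed_iInter fun i => isClosed_iInter fun _ =>
        isClosed_eq ((hfi i).comp continuous_subtype_val) continuous_const
    have hdir : Directed (· ⊇ ·) fun a : c => {y : C | r a.1.1 y.1} := by
      intro a b
      rcases eq_or_ne a.1 b.1 with hab | hab
      · exact ⟨a, subset_rfl, Subtype.ext hab ▸ subset_rfl⟩
      · rcases hc a.2 b.2 hab with h | h
        · exact ⟨b, fun y hy => hr h hy, subset_rfl⟩
        · exact ⟨a, subset_rfl, fun y hy => hr h hy⟩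
    obtain ⟨ub, hub⟩ := IsCompact.nonempty_iInter_of_directed_nonempty_isCompact_isClosed
      _ hdir (fun a => ⟨a.1, fun _ _ => rfl⟩) (fun a => (hcl a).isCompact) hcl
    exact ⟨ub, fun a ha => Set.mem_iInter.1 hub ⟨a, ha⟩⟩
  refine ⟨m, hAV fun i hi => ?_, ?_⟩
  · rw [m.2 i hi]
    exact (hu i hi).2
  let S : Set ι := (A : Set ι) ∪ Function.support (f m)
  have hS : S.Countable := A.countable_toSet.union (g m).2
  have : Countable S := hS.to_subtype
  let h : X → S → ℝ := fun x i => f x i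
  have hcont : Continuous h := continuous_pi fun i => hfi i
  -- A point agreeing with `m` on `S` lies in `C` and extends `m`, so by maximality it has no
  -- further non-zero coordinates.
  have hfib : h ⁻¹' {h m} = {m.1} := by
    refine Set.eq_singleton_iff_unique_mem.2 ⟨rfl, fun y hy => hf.injective ?_⟩
    have hy' : ∀ i ∈ S, f y i = f m i := fun i hi => congrFun hy ⟨i, hi⟩
    have hmy : r m y := fun i hi => hy' i (.inr hi)
    have hym := hm ⟨y, fun i hi => (hy' i (.inl hi)).trans (m.2 i hi)⟩ hmy
    ext i
    by_cases hi : f y i = 0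
    · by_cases hi' : f m i = 0
      · rw [hi, hi']
      · exact hmy i hi'
    · exact (hym i hi).symm
  have hnhds : 𝓝 m.1 = Filter.comap h (𝓝 (h m)) := by
    rw [hcont.isClosedMap.comap_nhds_eq hcont, hfib, nhdsSet_singleton]
  change (𝓝 m.1).IsCountablyGenerated
  rw [hnhds]
  infer_instance

theorem IsCorsonCompactum.t2Space {X : Type u} [TopologicalSpace X] (hX : IsCorsonCompactum X) :
    T2Space X := by
  obtain ⟨_, ι, g, hg⟩ := hX
  exact hg.t2Space

/-! ### The compactum `A(κ)^ω` and the product -/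

theorem OnePoint.isClopen_singleton_coe {I : Type*} [TopologicalSpace I] [DiscreteTopology I]
    (i : I) : IsClopen ({(i : OnePoint I)} : Set (OnePoint I)) := by
  refine ⟨isClosed_singleton, ?_⟩
  rw [← Set.image_singleton, OnePoint.isOpen_image_coe]
  exact isOpen_discrete _

/-- The isolated points of a one-point compactification of a discrete space are dense. -/
theorem OnePoint.dense_setOf_isOpen_singleton (I : Type*) [TopologicalSpace I]
    [DiscreteTopology I] : Dense {a : OnePoint I | IsOpen {a}} := by
  refine dense_iff_inter_open.2 fun V hV ⟨a, ha⟩ => ?_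
  by_cases h : ∃ i : I, (i : OnePoint I) ∈ V
  · obtain ⟨i, hi⟩ := h
    exact ⟨i, hi, (OnePoint.isClopen_singleton_coe i).2⟩
  · push Not at h
    have hVa : V = {a} := by
      refine Set.eq_singleton_iff_unique_mem.2 ⟨ha, fun b hb => ?_⟩
      have hinf : ∀ b ∈ V, b = OnePoint.infty := fun b hb => by
        induction b with
        | infty => rfl
        | coe i => exact absurd hb (h i)
      rw [hinf a ha, hinf b hb]
    rw [hVa] at hV
    exact ⟨a, ha, hV⟩

/-- The indicators of the clopen sets `x n = i` separate points, and for each `n` at most one `i`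
gives a non-zero value. -/
theorem isCorsonCompactum_nat_onePoint (I : Type u) [TopologicalSpace I] [DiscreteTopology I] :
    IsCorsonCompactum (ℕ → OnePoint I) := by
  classical
  refine ⟨inferInstance, ℕ × I, fun x => ⟨fun p => if x p.1 = p.2 then 1 else 0, ?_⟩, ?_⟩
  · have hsub : (Function.support fun p : ℕ × I => if x p.1 = p.2 then (1 : ℝ) else 0) ⊆
        ⋃ n, {p | p.1 = n ∧ x n = p.2} := by
      intro p hp
      have : x p.1 = p.2 := by
        by_contra hne
        exact hp (if_neg hne)
      exact Set.mem_iUnion.2 ⟨p.1, rfl, this⟩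
    refine (Set.countable_iUnion fun n => Set.Subsingleton.countable ?_).mono hsub
    rintro ⟨_, i⟩ ⟨rfl, hi⟩ ⟨_, j⟩ ⟨rfl, hj⟩
    have : i = j := OnePoint.coe_injective (hi.symm.trans hj)
    rw [this]
  · refine (Continuous.isClosedEmbedding ?_ ?_).isEmbedding
    · refine Continuous.subtype_mk (continuous_pi fun p => ?_) _
      refine IsLocallyConstant.continuous ?_
      have : IsLocallyConstant fun a : OnePoint I => if a = p.2 then (1 : ℝ) else 0 := by
        have hcl := OnePoint.isClopen_singleton_coe p.2
        refine (IsLocallyConstant.iff_eventually_eq _).2 fun a => ?_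
        by_cases ha : a = p.2
        · filter_upwards [hcl.2.mem_nhds ha] with b hb
          rw [if_pos ha, if_pos (Set.mem_singleton_iff.1 hb)]
        · filter_upwards [hcl.compl.2.mem_nhds ha] with b hb
          rw [if_neg ha, if_neg fun h => hb (Set.mem_singleton_iff.2 h)]
      exact this.comp_continuous (continuous_apply p.1)
    · intro x y hxy
      have h : ∀ n (i : I), x n = i ↔ y n = i := fun n i => by
        have := congrFun (congrArg Subtype.val hxy) (n, i)
        by_cases hx : x n = i <;> by_cases hy : y n = i <;> simp_all
      ext1 n
      generalize hx : x n = a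
      generalize hy : y n = b
      induction a with
      | coe i => exact ((h n i).1 hx).symm.trans hy
      | infty =>
        induction b with
        | infty => rfl
        | coe i => exact hx.symm.trans ((h n i).2 hy)

/-- The product of a Corson compactum `X` with `A(κ)^ω` has a dense metrizable subspace, where
`κ` is the cardinality of some `π`-base of `X`. -/
theorem IsCorsonCompactum.hasDenseMetrizableSubspace_prod {X : Type u} [TopologicalSpace X]
    (hX : IsCorsonCompactum X) {P : Set (Set X)} (hP : IsPiBase P) {I : Type u}
    [TopologicalSpace I] [DiscreteTopology I] (e : I ≃ P) :
    HasDenseMetrizableSubspace (X × (ℕ → OnePoint I)) := by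
  have := hX.t2Space
  let J : Set (OnePoint I) := {a | IsOpen {a}}
  have hJ : Dense (Set.univ.pi fun _ : ℕ => J) :=
    dense_pi _ fun _ _ => OnePoint.dense_setOf_isOpen_singleton I
  let cyl : (ℕ → OnePoint I) → ℕ → Set (ℕ → OnePoint I) := fun s n => {t | ∀ m ≤ n, t m = s m}
  have hcyl : ∀ s n, (∀ m ≤ n, s m ∈ J) → IsOpen (cyl s n) := by
    intro s n hs
    have : cyl s n = ⋂ m ∈ Set.Iic n, (fun t : ℕ → OnePoint I => t m) ⁻¹' {s m} := by
      ext t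
      simp [cyl]
    rw [this]
    exact (Set.finite_Iic n).isOpen_biInter fun m hm => IsOpen.preimage (continuous_apply m) (hs m hm : IsOpen {s m})
  -- The last fixed coordinate `s n` names the π-base member, so boxes over the same cylinder
  -- coincide, and distinct cylinders of length `n` are disjoint.
  refine hasDenseMetrizableSubspace_of_sigmaDisjoint (B := fun n => {S | ∃ s : ℕ → OnePoint I,
    (∀ m ≤ n, s m ∈ J) ∧ ∃ i : I, s n = i ∧ S = (e i).1 ×ˢ cyl s n}) ?_ ?_ ?_ ?_
  · refine (hX.dense_isCountablyGenerated_nhds.prod hJ).mono ?_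
    rintro ⟨x, t⟩ ⟨hx, ht⟩
    have : (𝓝 x).IsCountablyGenerated := hx
    have : ∀ n, (𝓝 (t n)).IsCountablyGenerated := fun n => by
      have htn : IsOpen {t n} := ht n trivial
      rw [(isOpen_singleton_iff_nhds_eq_pure _).1 htn]
      infer_instance
    change (𝓝 (x, t)).IsCountablyGenerated
    rw [nhds_prod_eq, nhds_pi]
    infer_instance
  · rintro n _ ⟨s, hs, i, -, rfl⟩
    exact (hP.1 _ (e i).2).1.prod (hcyl s n hs)
  · rintro n _ ⟨s, hs, i, hi, rfl⟩ _ ⟨s', hs', i', hi', rfl⟩ hne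
    refine Set.disjoint_left.2 ?_
    rintro ⟨x, t⟩ ⟨-, ht⟩ ⟨-, ht'⟩
    have heq : ∀ m ≤ n, s m = s' m := fun m hm => (ht m hm).symm.trans (ht' m hm)
    have hii : i = i' := OnePoint.coe_injective (hi.symm.trans ((heq n le_rfl).trans hi'))
    have hcc : cyl s n = cyl s' n := by
      ext w
      exact forall₂_congr fun m hm => by rw [heq m hm]
    exact hne (by rw [hii, hcc])
  · rintro V hV ⟨⟨x, t⟩, hxt⟩
    obtain ⟨V₁, V₂, hV₁, hV₂, hx, ht, hVV⟩ := isOpen_prod_iff.1 hV x t hxt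
    obtain ⟨U, hUP, hUV⟩ := hP.2 V₁ hV₁ ⟨x, hx⟩
    obtain ⟨s, hsV, hsJ⟩ := hJ.inter_open_nonempty V₂ hV₂ ⟨t, ht⟩
    obtain ⟨A, u, hu, hA⟩ := isOpen_pi_iff.1 hV₂ s hsV
    -- Coordinate `n` lies beyond those constrained by `V₂`, so it is free to hold the index of `U`.
    obtain ⟨n, hn⟩ : ∃ n, ∀ m ∈ A, m < n :=
      ⟨A.sup id + 1, fun m hm => Nat.lt_succ_of_le (Finset.le_sup (f := id) hm)⟩
    let i := e.symm ⟨U, hUP⟩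
    have hei : (e i).1 = U := by simp [i]
    let s' := Function.update s n (i : OnePoint I)
    refine ⟨n, _, ⟨s', fun m _ => ?_, i, Function.update_self .., rfl⟩, ?_, ?_⟩
    · by_cases hmn : m = n
      · subst hmn
        simpa [s', J] using (OnePoint.isClopen_singleton_coe i).2
      · simpa [s', hmn] using hsJ m trivial
    · exact (hei ▸ (hP.1 U hUP).2).prod ⟨s', fun _ _ => rfl⟩
    · refine (Set.prod_mono (hei ▸ hUV) fun w hw => hA fun m hm => ?_).trans hVV
      rw [hw m (hn m hm).le]
      simpa [s', (hn m hm).ne] using (hu m hm).2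

/-- For every Corson compactum `X` there is a non-empty Corson compactum `K` such that `X × K` has a dense
metrizable subspace; one can take `K = A(κ)^ω`, with `κ` the `π`-weight of `X` and `A(κ)` the
one-point compactification of a discrete set of cardinality `κ`. -/
theorem mainTheorem8 (X : Type u) [TopologicalSpace X] (hX : IsCorsonCompactum X) :
    (∃ (K : Type u) (_ : TopologicalSpace K),
      Nonempty K ∧ IsCorsonCompactum K ∧ HasDenseMetrizableSubspace (X × K)) ∧
    (∀ (I : Type u) [TopologicalSpace I] [DiscreteTopology I], #I = piWeight X →
      IsCorsonCompactum (ℕ → OnePoint I) ∧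
        HasDenseMetrizableSubspace (X × (ℕ → OnePoint I))) := by
  have key : ∀ (I : Type u) [TopologicalSpace I] [DiscreteTopology I], #I = piWeight X →
      IsCorsonCompactum (ℕ → OnePoint I) ∧
        HasDenseMetrizableSubspace (X × (ℕ → OnePoint I)) := by
    intro I _ _ hI
    obtain ⟨P, hP, hPX⟩ := exists_isPiBase_mk_eq_piWeight X
    obtain ⟨e⟩ := Cardinal.eq.1 (hI.trans hPX.symm)
    exact ⟨isCorsonCompactum_nat_onePoint I, hX.hasDenseMetrizableSubspace_prod hP e⟩
  refine ⟨?_, key⟩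
  let : TopologicalSpace (piWeight X).out := ⊥
  have : DiscreteTopology (piWeight X).out := ⟨rfl⟩
  exact ⟨ℕ → OnePoint (piWeight X).out, inferInstance, inferInstance,
    key _ (Cardinal.mk_out _)⟩
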